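/- Fix $n\in\mathbb N=\{1,2,\dots\}$. Coupons arrive one by one at times $1,2,3,\dots$; their types are independent and uniformly distributed on a set of $n$ types. Collectors are labelled $0,1,2,\dots$ and all start with empty albums. Each arriving coupon is put in the album of the collector with the smallest label whose album does not yet contain a coupon of this type. For $r\in\mathbb N_0=\{0,1,2,\dots\}$, let $T_r^{(n)}$ be the time at which the album of collector $r$ first contains all $n$ types. For $r_1,r_2\in\mathbb N_0$ with $r_2>r_1$, let $\Delta_{r_1,r_2}^{(n)}=T_{r_2}^{(n)}-T_{r_1}^{(n)}$, and let $L_{r_1,r_2}$ be a logistic random variable with distribution function \[\mathbb P\{L_{r_1,r_2}<x\}=\frac{r_2!}{r_2!+r_1!\,\mathrm e^{-x}},\qquad x\in\mathbb R.\] Then \[\frac{\Delta_{r_1,r_2}^{(n)}}{n}-(r_2-r_1)\ln\ln n\ \xrightarrow{d}\ L_{r_1,r_2}\qquad\text{as }n\to\infty,\] where $\xrightarrow{d}$ denotes convergence in distribution. -/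

import Mathlib

open MeasureTheory ProbabilityTheory Filter

/-- The albums of the collectors. The coupon `c t` is the `(t + 1)`-st to arrive, and
`album c t r` is the set of coupon types in the album of the collector labelled `r` after `t`
arrivals. All the albums are empty at first. An arriving coupon goes down the line
`0, 1, 2, …`: it reaches collector `r` when every collector `s < r` already has its type, and he
puts it in his album unless he has its type as well. -/
def album {α : Type*} (c : ℕ → α) : ℕ → ℕ → Set α
  | 0, _ => ∅
  | t + 1, r => {i | i ∈ album c t r ∨ (c t = i ∧ ∀ s < r, i ∈ album c t s)}

/-- The time at which collector `r` completes his collection: the least number of arrivals after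
which his album contains every type. (It is `0` by convention if this never happens, which for
uniform independent coupons is an event of probability zero.) -/
noncomputable def completionTime {α : Type*} (c : ℕ → α) (r : ℕ) : ℕ :=
  sInf {t | album c t r = Set.univ}

/-- The inter-completion time `T_{r₂} - T_{r₁}`. -/
noncomputable def interCompletionTime {α : Type*} (c : ℕ → α) (r₁ r₂ : ℕ) : ℝ :=
  (completionTime c r₂ : ℝ) - (completionTime c r₁ : ℝ)

open scoped Nat NNReal Topology ENNReal

/-! Collector `r` owns type `i` exactly when `i` has arrived more than `r` times, so `T_r` is the
first time at which all `n` counts exceed `r`. At a fixed time the counts are multinomial, hence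
dependent. If instead two consecutive blocks of arrivals have independent Poisson lengths of means
`n a` and `n b`, all counts in both blocks are independent Poisson variables
(`map_poissonizedCount`), and the probability that both collections are complete at the ends of the
respective blocks is an exact `n`-th power (`poissonized_real_eq`).

Take `a = log n + r₁ log log n + x` and `a + b = log n + r₂ log log n + y`. A given type fails the
first or the second requirement with probability about `exp (-x) / (r₁! n)` or `exp (-y) / (r₂! n)`.
It fails both with probability `o(1/n)`, because `b → ∞` when `r₁ < r₂`. The `n`-th power therefore
tends to `exp (-(exp (-x) / r₁! + exp (-y) / r₂!))`: the normalized times become independent Gumbel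
variables.

To return to fixed times, Chebyshev's inequality shows that the block lengths are within `n ε` of
their means up to probability `O(log n / n)`. Completion is monotone in time, so the true
probability is squeezed between Poissonized ones with shifted `x` and `y`. Finally, the difference
of the two Gumbel limits is logistic (`real_gumbel_sub_gumbel_lt`), and the continuous mapping
theorem applies. -/

/-- The number of arrivals `k ∈ A` at which the coupon is of type `i`. -/
def couponCount {α : Type*} [DecidableEq α] (c : ℕ → α) (A : Finset ℕ) (i : α) : ℕ :=
  (A.filter fun k => c k = i).card

/-! ### Albums in terms of coupon counts -/

section couponCount

variable {α : Type*} [DecidableEq α]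

theorem couponCount_union (c : ℕ → α) {A B : Finset ℕ} (h : Disjoint A B) :
    couponCount c (A ∪ B) = couponCount c A + couponCount c B := by
  ext i
  simp only [couponCount, Pi.add_apply, Finset.filter_union]
  exact Finset.card_union_of_disjoint (Finset.disjoint_filter_filter h)

theorem couponCount_singleton (c : ℕ → α) (k : ℕ) : couponCount c {k} = Pi.single (c k) 1 := by
  ext i
  by_cases h : c k = i
  · subst h
    simp [couponCount, Finset.filter_singleton]
  · simp [couponCount, Finset.filter_singleton, h, Ne.symm h]

theorem couponCount_mono (c : ℕ → α) {A B : Finset ℕ} (h : A ⊆ B) (i : α) :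
    couponCount c A i ≤ couponCount c B i :=
  Finset.card_le_card (Finset.filter_subset_filter _ h)

theorem sum_couponCount [Fintype α] (c : ℕ → α) (A : Finset ℕ) :
    ∑ i, couponCount c A i = A.card :=
  (Finset.card_eq_sum_card_fiberwise (fun _ _ => Finset.mem_coe.2 (Finset.mem_univ _))).symm

theorem couponCount_range_add (c : ℕ → α) (m l : ℕ) (i : α) :
    couponCount c (Finset.range m) i + couponCount c (Finset.Ico m (m + l)) i =
      couponCount c (Finset.range (m + l)) i := by
  have hd : Disjoint (Finset.range m) (Finset.Ico m (m + l)) := by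
    rw [Finset.disjoint_left]
    intro k hk hk'
    simp at hk hk'
    omega
  have hu : Finset.range m ∪ Finset.Ico m (m + l) = Finset.range (m + l) := by
    ext k
    simp
    omega
  rw [← hu, couponCount_union c hd, Pi.add_apply]

theorem couponCount_range_succ (c : ℕ → α) (t : ℕ) (i : α) :
    couponCount c (Finset.range (t + 1)) i =
      couponCount c (Finset.range t) i + if c t = i then 1 else 0 := by
  rw [← couponCount_range_add c t 1 i]
  simp [couponCount, Finset.filter_singleton]
  split_ifs <;> simp

/-- The owners of a type always form an initial segment of the collectors, whose length is the
number of its arrivals; one more coupon of the type extends the segment by one. -/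
theorem mem_album_iff (c : ℕ → α) (t r : ℕ) (i : α) :
    i ∈ album c t r ↔ r < couponCount c (Finset.range t) i := by
  induction t generalizing r with
  | zero => simp [album, couponCount]
  | succ t ih =>
    simp only [album, Set.mem_ofPred_eq, ih, couponCount_range_succ]
    by_cases h : c t = i
    · simp only [h, true_and, if_true]
      constructor
      · rintro (h1 | h1)
        · omega
        · by_contra h2
          exact lt_irrefl _ (h1 (couponCount c (Finset.range t) i) (by omega))
      · intro h1
        exact Or.inr fun s hs => by omega
    · simp [h]

theorem album_eq_univ_iff (c : ℕ → α) (t r : ℕ) :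
    album c t r = Set.univ ↔ ∀ i, r < couponCount c (Finset.range t) i := by
  simp [Set.eq_univ_iff_forall, mem_album_iff]

/-- The hypothesis excludes the conventional value `sInf ∅ = 0`. -/
theorem completionTime_le_iff (c : ℕ → α) (r m : ℕ)
    (h : ∃ t, album c t r = Set.univ) :
    completionTime c r ≤ m ↔ ∀ i, r < couponCount c (Finset.range m) i := by
  constructor
  · intro hm i
    have := Nat.sInf_mem (s := {t | album c t r = Set.univ}) h
    exact ((album_eq_univ_iff c _ r).1 this i).trans_le
      (couponCount_mono c (Finset.range_mono hm) i)
  · intro hm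
    exact Nat.sInf_le ((album_eq_univ_iff c m r).2 hm)

theorem exists_album_eq_univ [Fintype α] (c : ℕ → α) (r : ℕ)
    (h : ∀ i, ∃ᶠ k in atTop, c k = i) : ∃ t, album c t r = Set.univ := by
  have key : ∀ (i : α) (m : ℕ), ∃ t, m < couponCount c (Finset.range t) i := by
    intro i m
    induction m with
    | zero =>
      obtain ⟨k, -, hk⟩ := (frequently_atTop.1 (h i)) 0
      exact ⟨k + 1, by simp [couponCount_range_succ, hk]⟩
    | succ m ih =>
      obtain ⟨t, ht⟩ := ih
      obtain ⟨k, hkt, hk⟩ := (frequently_atTop.1 (h i)) t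
      refine ⟨k + 1, ?_⟩
      have := couponCount_mono c (Finset.range_mono hkt) i
      simp only [couponCount_range_succ, hk, if_true]
      omega
  choose t ht using fun i => key i r
  refine ⟨Finset.univ.sup t, (album_eq_univ_iff c _ r).2 fun i => (ht i).trans_le ?_⟩
  exact couponCount_mono c (Finset.range_mono (Finset.le_sup (Finset.mem_univ i))) i

end couponCount

/-! ### Multinomial law and Poissonization -/

section CouponLaw

variable {Ω : Type*} [MeasurableSpace Ω] {P : Measure Ω} {n : ℕ} {C : ℕ → Ω → Fin n}

theorem measurable_couponCount (hC : ∀ k, Measurable (C k)) (A : Finset ℕ) :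
    Measurable fun ω => couponCount (fun k => C k ω) A := by
  refine measurable_pi_lambda _ fun i => ?_
  simp only [couponCount, Finset.card_filter]
  refine Finset.measurable_sum _ fun k _ => ?_
  exact Measurable.ite (hC k (measurableSet_singleton i)) measurable_const measurable_const

theorem indepFun_couponCount (hC : ∀ k, Measurable (C k)) (hind : iIndepFun C P)
    {A B : Finset ℕ} (h : Disjoint A B) :
    IndepFun (fun ω => couponCount (fun k => C k ω) A)
      (fun ω => couponCount (fun k => C k ω) B) P := by
  have key : ∀ D : Finset ℕ, (fun ω => couponCount (fun k => C k ω) D) =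
      (fun (v : D → Fin n) (i : Fin n) => ∑ k, if v k = i then 1 else 0) ∘
        fun ω (k : D) => C k ω := by
    intro D
    ext ω i
    simp only [couponCount, Finset.card_filter, Function.comp]
    exact (Finset.sum_coe_sort D fun k => if C k ω = i then 1 else 0).symm
  rw [key A, key B]
  exact (hind.indepFun_finset A B h hC).comp (measurable_of_countable _)
    (measurable_of_countable _)

theorem measureReal_inter_of_indepFun {β γ : Type*} [MeasurableSpace β] [MeasurableSpace γ]
    {f : Ω → β} {g : Ω → γ} (h : IndepFun f g P) {s : Set β} {t : Set γ} (hs : MeasurableSet s)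
    (ht : MeasurableSet t) :
    P.real ({ω | f ω ∈ s} ∩ {ω | g ω ∈ t}) = P.real {ω | f ω ∈ s} * P.real {ω | g ω ∈ t} := by
  simp only [measureReal_def, ← ENNReal.toReal_mul]
  exact congrArg ENNReal.toReal (h.measure_inter_preimage_eq_mul s t hs ht)

theorem prod_factorial_eq_mul_prod_factorial_sub_single {ι : Type*} [Fintype ι] [DecidableEq ι]
    (j : ι → ℕ) (i : ι) (hi : j i ≠ 0) :
    ∏ l, (j l)! = j i * ∏ l, ((j - Pi.single i 1 : ι → ℕ) l)! := by
  have h1 := Finset.mul_prod_erase Finset.univ (fun l => (j l)!) (Finset.mem_univ i)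
  have h2 := Finset.mul_prod_erase Finset.univ (fun l => ((j - Pi.single i 1 : ι → ℕ) l)!)
    (Finset.mem_univ i)
  refine h1.symm.trans (Eq.trans ?_ (congrArg (j i * ·) h2))
  rw [← mul_assoc]
  congr 1
  · simp [Nat.mul_factorial_pred hi]
  · refine Finset.prod_congr rfl fun l hl => ?_
    simp [Finset.ne_of_mem_erase hl]

/-- The multinomial law, by splitting on the type `i` of one arrival. Type `i` contributes in
proportion to `j i`, and `∑ i, j i = A.card + 1` supplies the next factor of the factorial. -/
theorem measureReal_couponCount_eq [IsProbabilityMeasure P] (hC : ∀ k, Measurable (C k))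
    (hind : iIndepFun C P) (hunif : ∀ k i, P.real {ω | C k ω = i} = 1 / (n : ℝ))
    (A : Finset ℕ) (j : Fin n → ℕ) (hj : ∑ i, j i = A.card) :
    P.real {ω | couponCount (fun k => C k ω) A = j} =
      (A.card ! : ℝ) / (∏ i, (j i)! : ℕ) / (n : ℝ) ^ A.card := by
  induction A using Finset.induction_on generalizing j with
  | empty =>
    have hj0 : j = 0 := by
      ext i
      exact (Finset.sum_eq_zero_iff.1 hj) i (Finset.mem_univ i)
    have : ∀ ω, couponCount (fun k => C k ω) ∅ = j := by
      intro ω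
      ext i
      simp [couponCount, hj0]
    simp [this, hj0]
  | insert a A ha ih =>
    have hd : Disjoint A {a} := by simpa using ha
    have hsplit : {ω | couponCount (fun k => C k ω) (insert a A) = j} =
        ⋃ i : Fin n, {ω | couponCount (fun k => C k ω) A + Pi.single i 1 = j} ∩
          {ω | C a ω = i} := by
      ext ω
      have h : insert a A = A ∪ {a} := by ext; simp
      simp only [h, couponCount_union _ hd, couponCount_singleton, Set.mem_ofPred_eq,
        Set.mem_iUnion, Set.mem_inter_iff]
      exact ⟨fun h => ⟨_, h, rfl⟩, fun ⟨i, h, hi⟩ => hi ▸ h⟩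
    have hmA := measurable_couponCount hC A
    have hm : ∀ i, MeasurableSet
        {ω | couponCount (fun k => C k ω) A + Pi.single i 1 = j} := fun i =>
      measurableSet_eq_fun (hmA.add_const _) measurable_const
    rw [hsplit, measureReal_iUnion_fintype]
    rotate_left
    · intro i i' hii
      rw [Function.onFun, Set.disjoint_left]
      rintro ω ⟨-, h1⟩ ⟨-, h2⟩
      exact hii (h1.symm.trans h2)
    · exact fun i => (hm i).inter (hC a (measurableSet_singleton i))
    have hterm : ∀ i, P.real ({ω | couponCount (fun k => C k ω) A + Pi.single i 1 = j} ∩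
        {ω | C a ω = i}) =
        (j i : ℝ) * ((A.card ! : ℝ) / (∏ i, (j i)! : ℕ) / (n : ℝ) ^ A.card) * (1 / n) := by
      intro i
      have hI := measureReal_inter_of_indepFun (indepFun_couponCount hC hind hd)
        (s := {v : Fin n → ℕ | v + Pi.single i 1 = j}) (t := {v : Fin n → ℕ | v = Pi.single i 1})
        MeasurableSet.of_discrete MeasurableSet.of_discrete
      simp only [Set.mem_ofPred_eq] at hI
      have hCa : {ω | couponCount (fun k => C k ω) {a} = Pi.single i 1} = {ω | C a ω = i} := by
        ext ω
        simp only [couponCount_singleton, Set.mem_ofPred_eq]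
        exact ⟨fun h => by
          by_contra h'
          have := congrFun h i
          simp [Ne.symm h'] at this, fun h => by rw [h]⟩
      rw [hCa, hunif] at hI
      refine hI.trans ?_
      congr 1
      -- If `j i = 0` the event is empty; this case is separate because truncated subtraction of
      -- `Pi.single i 1` could not be undone.
      by_cases hi : j i = 0
      · have : {ω | couponCount (fun k => C k ω) A + Pi.single i 1 = j} = ∅ := by
          ext ω
          simp only [Set.mem_ofPred_eq, Set.mem_empty_iff_false, iff_false]
          intro h
          have := congrFun h i
          simp at this
          omega
        simp [this, hi]
      · have hle : Pi.single i 1 ≤ j := by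
          intro l
          by_cases hl : l = i
          · subst hl; simp; omega
          · simp [hl]
        have hset : {ω | couponCount (fun k => C k ω) A + Pi.single i 1 = j} =
            {ω | couponCount (fun k => C k ω) A = j - Pi.single i 1} := by
          ext ω
          simp only [Set.mem_ofPred_eq]
          constructor
          · rintro rfl
            simp
          · intro h
            rw [h, tsub_add_cancel_of_le hle]
        have hsum : ∑ l, (j - Pi.single i 1 : Fin n → ℕ) l = A.card := by
          have h1 : ∑ l, j l = ∑ l, (j - Pi.single i 1 : Fin n → ℕ) l + 1 := by
            conv_lhs => rw [← tsub_add_cancel_of_le hle]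
            simp [Finset.sum_add_distrib]
          rw [Finset.card_insert_of_notMem ha] at hj
          omega
        rw [hset, ih _ hsum, prod_factorial_eq_mul_prod_factorial_sub_single j i hi]
        have : (j i : ℝ) ≠ 0 := by exact_mod_cast hi
        push_cast
        field_simp
    rw [Finset.sum_congr rfl fun i _ => hterm i, ← Finset.sum_mul, ← Finset.sum_mul,
      ← Nat.cast_sum, hj, Finset.card_insert_of_notMem ha, Nat.factorial_succ, pow_succ]
    push_cast
    ring

theorem measurable_poissonizedCount (hC : ∀ k, Measurable (C k)) :
    Measurable fun (p : Ω × ℕ × ℕ) (i : Fin n) =>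
      (couponCount (fun k => C k p.1) (Finset.range p.2.1) i,
        couponCount (fun k => C k p.1) (Finset.Ico p.2.1 (p.2.1 + p.2.2)) i) := by
  refine measurable_from_prod_countable_left fun q => ?_
  refine measurable_pi_lambda _ fun i => ?_
  exact ((measurable_pi_apply i).comp (measurable_couponCount hC (Finset.range q.1))).prodMk
    ((measurable_pi_apply i).comp (measurable_couponCount hC (Finset.Ico q.1 (q.1 + q.2))))

/-- **Poissonization**: if the lengths of two consecutive blocks of arrivals are independent
Poisson variables, then the numbers of coupons of each type in each block are independent Poisson
variables. -/
theorem map_poissonizedCount [IsProbabilityMeasure P] (hn : n ≠ 0) (hC : ∀ k, Measurable (C k))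
    (hind : iIndepFun C P) (hunif : ∀ k i, P.real {ω | C k ω = i} = 1 / (n : ℝ))
    (a b : ℝ≥0) :
    (P.prod ((poissonMeasure (n * a)).prod (poissonMeasure (n * b)))).map
      (fun (p : Ω × ℕ × ℕ) (i : Fin n) =>
        (couponCount (fun k => C k p.1) (Finset.range p.2.1) i,
          couponCount (fun k => C k p.1) (Finset.Ico p.2.1 (p.2.1 + p.2.2)) i)) =
      Measure.pi fun _ => (poissonMeasure a).prod (poissonMeasure b) := by
  refine Measure.ext_of_singleton fun v => ?_
  rw [← ENNReal.toReal_eq_toReal_iff' (measure_ne_top _ _) (measure_ne_top _ _),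
    Measure.map_apply (measurable_poissonizedCount hC) (measurableSet_singleton v)]
  set m := ∑ i, (v i).1 with hm
  set l := ∑ i, (v i).2 with hl
  -- The counts determine the block lengths as their sums `m` and `l`, so the preimage of a point is
  -- a rectangle. The factors `m !`, `l !` and the powers of `n` then cancel between the multinomial
  -- and Poisson weights.
  have hset : (fun (p : Ω × ℕ × ℕ) (i : Fin n) =>
        (couponCount (fun k => C k p.1) (Finset.range p.2.1) i,
          couponCount (fun k => C k p.1) (Finset.Ico p.2.1 (p.2.1 + p.2.2)) i)) ⁻¹' {v} =
      ({ω | couponCount (fun k => C k ω) (Finset.range m) = fun i => (v i).1} ∩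
        {ω | couponCount (fun k => C k ω) (Finset.Ico m (m + l)) = fun i => (v i).2}) ×ˢ
        ({m} ×ˢ {l}) := by
    ext ⟨ω, p, q⟩
    simp only [Set.mem_preimage, Set.mem_singleton_iff, Set.mem_prod, Set.mem_inter_iff,
      Set.mem_ofPred_eq]
    constructor
    · intro h
      have h1 : ∀ i, couponCount (fun k => C k ω) (Finset.range p) i = (v i).1 := fun i =>
        congrArg Prod.fst (congrFun h i)
      have h2 : ∀ i, couponCount (fun k => C k ω) (Finset.Ico p (p + q)) i = (v i).2 := fun i =>
        congrArg Prod.snd (congrFun h i)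
      have hp : p = m := by
        rw [hm, ← Finset.sum_congr rfl fun i _ => h1 i, sum_couponCount, Finset.card_range]
      have hq : q = l := by
        rw [hl, ← Finset.sum_congr rfl fun i _ => h2 i, sum_couponCount, Nat.card_Ico]
        omega
      subst hp hq
      exact ⟨⟨funext h1, funext h2⟩, rfl, rfl⟩
    · rintro ⟨⟨h1, h2⟩, rfl, rfl⟩
      ext i
      · exact congrFun h1 i
      · exact congrFun h2 i
  have hd : Disjoint (Finset.range m) (Finset.Ico m (m + l)) := by
    rw [Finset.disjoint_left]
    intro k hk hk'
    simp at hk hk'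
    omega
  have hI := measureReal_inter_of_indepFun (indepFun_couponCount hC hind hd)
    (s := {w : Fin n → ℕ | w = fun i => (v i).1}) (t := {w : Fin n → ℕ | w = fun i => (v i).2})
    MeasurableSet.of_discrete MeasurableSet.of_discrete
  have e1 := measureReal_couponCount_eq hC hind hunif (Finset.range m) (fun i => (v i).1) (by
    simp [hm])
  have e2 := measureReal_couponCount_eq hC hind hunif (Finset.Ico m (m + l)) (fun i => (v i).2) (by
    simp [hl])
  simp only [Set.mem_ofPred_eq] at hI
  rw [e1, e2, Finset.card_range, Nat.card_Ico, Nat.add_sub_cancel_left] at hI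
  rw [hset, Measure.prod_prod, Measure.prod_prod, Measure.pi_singleton]
  simp only [ENNReal.toReal_mul, ENNReal.toReal_prod]
  have hv : ∀ i, ((poissonMeasure a).prod (poissonMeasure b)).real {v i} =
      Real.exp (-a) * a ^ (v i).1 / ((v i).1)! * (Real.exp (-b) * b ^ (v i).2 / ((v i).2)!) := by
    intro i
    rw [← poissonMeasure_real_singleton, ← poissonMeasure_real_singleton, ← measureReal_prod_prod,
      Set.singleton_prod_singleton]
  simp only [← measureReal_def, poissonMeasure_real_singleton, hI, hv]
  rw [Finset.prod_mul_distrib, Finset.prod_div_distrib, Finset.prod_div_distrib,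
    Finset.prod_mul_distrib, Finset.prod_mul_distrib, Finset.prod_pow_eq_pow_sum,
    Finset.prod_pow_eq_pow_sum, ← hm, ← hl]
  have hn' : (n : ℝ) ≠ 0 := by exact_mod_cast hn
  have hpa : ((∏ i, ((v i).1)! : ℕ) : ℝ) ≠ 0 := by
    exact_mod_cast (Finset.prod_ne_zero_iff.2 fun i _ => (Nat.factorial_ne_zero _))
  have hpb : ((∏ i, ((v i).2)! : ℕ) : ℝ) ≠ 0 := by
    exact_mod_cast (Finset.prod_ne_zero_iff.2 fun i _ => (Nat.factorial_ne_zero _))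
  have hma : (m ! : ℝ) ≠ 0 := by positivity
  have hlb : (l ! : ℝ) ≠ 0 := by positivity
  simp only [Finset.prod_const, Finset.card_univ, Fintype.card_fin, ← Real.exp_nat_mul]
  push_cast at hpa hpb ⊢
  rw [mul_neg, mul_neg, mul_pow, mul_pow]
  field_simp

end CouponLaw

/-! ### Poisson variance and Chebyshev's inequality -/

section PoissonTail

theorem hasSum_nat_mul_poisson (r : ℝ≥0) :
    HasSum (fun k : ℕ => Real.exp (-r) * r ^ k / k ! * k) r := by
  rw [← hasSum_nat_add_iff' 1]
  have h := (hasSum_one_poissonMeasure r).mul_left (r : ℝ)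
  simp only [mul_one] at h
  simp only [Finset.sum_range_one, Nat.cast_zero, mul_zero, sub_zero]
  refine h.congr_fun fun k => ?_
  rw [Nat.factorial_succ]
  push_cast
  field_simp
  ring

theorem hasSum_nat_mul_pred_mul_poisson (r : ℝ≥0) :
    HasSum (fun k : ℕ => Real.exp (-r) * r ^ k / k ! * (k * (k - 1))) (r ^ 2 : ℝ) := by
  rw [← hasSum_nat_add_iff' 2]
  have h := (hasSum_one_poissonMeasure r).mul_left ((r : ℝ) ^ 2)
  simp only [mul_one] at h
  simp only [Finset.sum_range_succ, Finset.sum_range_zero, Nat.cast_zero, Nat.cast_one, zero_mul,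
    mul_zero, sub_self, sub_zero, add_zero]
  refine h.congr_fun fun k => ?_
  rw [Nat.factorial_succ, Nat.factorial_succ]
  push_cast
  field_simp
  ring

theorem hasSum_sq_sub_mul_poisson (r : ℝ≥0) :
    HasSum (fun k : ℕ => Real.exp (-r) * r ^ k / k ! * (k - r) ^ 2) r := by
  -- Uses `(k - r)² = k (k - 1) + (1 - 2 r) k + r²`.
  have h := ((hasSum_nat_mul_pred_mul_poisson r).add
    ((hasSum_nat_mul_poisson r).mul_left (1 - 2 * (r : ℝ)))).add
    ((hasSum_one_poissonMeasure r).mul_left ((r : ℝ) ^ 2))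
  have e : (r : ℝ) ^ 2 + (1 - 2 * r) * r + r ^ 2 * 1 = r := by ring
  rw [e] at h
  exact h.congr_fun fun k => by ring

/-- Chebyshev's inequality for the Poisson distribution. -/
theorem poissonMeasure_real_le_abs_sub_le (r : ℝ≥0) {c : ℝ} (hc : 0 < c) :
    (poissonMeasure r).real {k : ℕ | c ≤ |(k : ℝ) - r|} ≤ r / c ^ 2 := by
  have hs := hasSum_sq_sub_mul_poisson r
  have hint : Integrable (fun k : ℕ => ((k : ℝ) - r) ^ 2) (poissonMeasure r) := by
    rw [integrable_poissonMeasure_iff]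
    refine hs.summable.congr fun k => ?_
    rw [Real.norm_of_nonneg (sq_nonneg _)]
  have hval : ∫ k : ℕ, ((k : ℝ) - r) ^ 2 ∂poissonMeasure r = r := by
    refine (hasSum_integral_poissonMeasure hint).unique ?_
    simpa only [smul_eq_mul] using hs
  have h := mul_meas_ge_le_integral_of_nonneg (ae_of_all _ fun k : ℕ => sq_nonneg ((k : ℝ) - r))
    hint (c ^ 2)
  rw [hval] at h
  have hset : {k : ℕ | c ^ 2 ≤ ((k : ℝ) - r) ^ 2} = {k : ℕ | c ≤ |(k : ℝ) - r|} := by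
    ext k
    simp only [Set.mem_ofPred_eq]
    rw [← sq_abs ((k : ℝ) - r)]
    exact pow_le_pow_iff_left₀ hc.le (abs_nonneg _) two_ne_zero
  rw [hset] at h
  rw [le_div_iff₀ (by positivity)]
  linarith

end PoissonTail

/-! ### Comparison of fixed and Poissonized times -/

section Sandwich

/-- The event that after `m` arrivals each type has come more than `r₁` times and after `m'`
arrivals more than `r₂` times. -/
def completedBy {Ω : Type*} {n : ℕ} (C : ℕ → Ω → Fin n) (r₁ r₂ m m' : ℕ) : Set Ω :=
  {ω | ∀ i, r₁ < couponCount (fun k => C k ω) (Finset.range m) i ∧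
    r₂ < couponCount (fun k => C k ω) (Finset.range m') i}

theorem completedBy_mono {Ω : Type*} {n : ℕ} (C : ℕ → Ω → Fin n) (r₁ r₂ : ℕ) {m m' k k' : ℕ} (h : m ≤ k)
    (h' : m' ≤ k') : completedBy C r₁ r₂ m m' ⊆ completedBy C r₁ r₂ k k' := fun _ hω i =>
  ⟨(hω i).1.trans_le (couponCount_mono _ (Finset.range_mono h) i),
    (hω i).2.trans_le (couponCount_mono _ (Finset.range_mono h') i)⟩

variable {Ω : Type*} [MeasurableSpace Ω] {P : Measure Ω} [IsProbabilityMeasure P] {n : ℕ}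
  {C : ℕ → Ω → Fin n}

/-- The probability that a Poisson process exceeds `r₁` by time `a` and `r₂` by time `a + b`. -/
noncomputable def poissonExceed (r₁ r₂ : ℕ) (a b : ℝ≥0) : ℝ :=
  ((poissonMeasure a).prod (poissonMeasure b)).real {q | r₁ < q.1 ∧ r₂ < q.1 + q.2}

/-- The event imposes the same condition on each type separately, and under Poissonization the types
are independent and identically distributed. -/
theorem poissonized_real_eq (hn : n ≠ 0) (hC : ∀ k, Measurable (C k))
    (hind : iIndepFun C P) (hunif : ∀ k i, P.real {ω | C k ω = i} = 1 / (n : ℝ))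
    (r₁ r₂ : ℕ) (a b : ℝ≥0) :
    (P.prod ((poissonMeasure (n * a)).prod (poissonMeasure (n * b)))).real
      {p | p.1 ∈ completedBy C r₁ r₂ p.2.1 (p.2.1 + p.2.2)} = poissonExceed r₁ r₂ a b ^ n := by
  have h := congrArg (fun μ : Measure (Fin n → ℕ × ℕ) => μ.real
    (Set.pi Set.univ fun _ => {q : ℕ × ℕ | r₁ < q.1 ∧ r₂ < q.1 + q.2}))
    (map_poissonizedCount hn hC hind hunif a b)
  simp only [measureReal_def] at h
  rw [Measure.map_apply (measurable_poissonizedCount hC) MeasurableSet.of_discrete,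
    Measure.pi_pi] at h
  simp only [Finset.prod_const, Finset.card_univ, Fintype.card_fin, ENNReal.toReal_pow] at h
  rw [poissonExceed, measureReal_def, measureReal_def, ← h]
  congr 2
  ext ⟨ω, p, q⟩
  simp [completedBy, couponCount_range_add]

theorem poissonized_deviation_le (a b : ℝ≥0) {c : ℝ} (hc : 0 < c) :
    (P.prod ((poissonMeasure (n * a)).prod (poissonMeasure (n * b)))).real
      {p | c ≤ |(p.2.1 : ℝ) - n * a| ∨ c ≤ |(p.2.2 : ℝ) - n * b|} ≤ n * (a + b) / c ^ 2 := by
  have hset : {p : Ω × ℕ × ℕ | c ≤ |(p.2.1 : ℝ) - n * a| ∨ c ≤ |(p.2.2 : ℝ) - n * b|} =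
      (Set.univ ×ˢ ({k : ℕ | c ≤ |(k : ℝ) - n * a|} ×ˢ Set.univ)) ∪
      (Set.univ ×ˢ (Set.univ ×ˢ {k : ℕ | c ≤ |(k : ℝ) - n * b|})) := by
    ext p
    simp
  rw [hset]
  refine (measureReal_union_le _ _).trans ?_
  simp only [measureReal_prod_prod, probReal_univ, one_mul, mul_one]
  have h1 := poissonMeasure_real_le_abs_sub_le (n * a) hc
  have h2 := poissonMeasure_real_le_abs_sub_le (n * b) hc
  push_cast at h1 h2
  calc _ ≤ _ := add_le_add h1 h2
    _ = _ := by ring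

/-- Unless a block length deviates by at least `c`, the random times are no earlier than `s` and
`t`, so completion by the fixed times implies completion by the random ones. -/
theorem measureReal_completedBy_le (hn : n ≠ 0) (hC : ∀ k, Measurable (C k))
    (hind : iIndepFun C P) (hunif : ∀ k i, P.real {ω | C k ω = i} = 1 / (n : ℝ))
    (r₁ r₂ : ℕ) (a b : ℝ≥0) {c s t : ℝ} (hc : 0 < c)
    (hsa : s ≤ n * a - c) (htb : t - s ≤ n * b - c) :
    P.real (completedBy C r₁ r₂ ⌊s⌋₊ ⌊t⌋₊) ≤
      poissonExceed r₁ r₂ a b ^ n + n * (a + b) / c ^ 2 := by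
  have hsub : completedBy C r₁ r₂ ⌊s⌋₊ ⌊t⌋₊ ×ˢ (Set.univ : Set (ℕ × ℕ)) ⊆
      {p | p.1 ∈ completedBy C r₁ r₂ p.2.1 (p.2.1 + p.2.2)} ∪
      {p | c ≤ |(p.2.1 : ℝ) - n * a| ∨ c ≤ |(p.2.2 : ℝ) - n * b|} := by
    rintro ⟨ω, p, q⟩ ⟨hω, -⟩
    by_cases h : c ≤ |(p : ℝ) - n * a| ∨ c ≤ |(q : ℝ) - n * b|
    · exact Or.inr h
    · left
      push Not at h
      have h1 := (abs_lt.1 h.1).1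
      have h2 := (abs_lt.1 h.2).1
      refine completedBy_mono C r₁ r₂ ?_ ?_ hω
      · exact Nat.floor_le_of_le (by linarith)
      · exact Nat.floor_le_of_le (by push_cast; linarith)
  have h := (measureReal_mono hsub (μ := P.prod ((poissonMeasure (n * a)).prod
    (poissonMeasure (n * b))))).trans (measureReal_union_le _ _)
  rw [measureReal_prod_prod, probReal_univ, mul_one,
    poissonized_real_eq hn hC hind hunif] at h
  exact h.trans (by gcongr; exact poissonized_deviation_le a b hc)

/-- The mirror image: without a large deviation the random times do not exceed `s` and `t`. -/
theorem le_measureReal_completedBy (hn : n ≠ 0) (hC : ∀ k, Measurable (C k))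
    (hind : iIndepFun C P) (hunif : ∀ k i, P.real {ω | C k ω = i} = 1 / (n : ℝ))
    (r₁ r₂ : ℕ) (a b : ℝ≥0) {c s t : ℝ} (hc : 0 < c)
    (hsa : n * a + c ≤ s) (htb : n * b + c ≤ t - s) :
    poissonExceed r₁ r₂ a b ^ n ≤
      P.real (completedBy C r₁ r₂ ⌊s⌋₊ ⌊t⌋₊) + n * (a + b) / c ^ 2 := by
  have hsub : {p : Ω × ℕ × ℕ | p.1 ∈ completedBy C r₁ r₂ p.2.1 (p.2.1 + p.2.2)} ⊆
      completedBy C r₁ r₂ ⌊s⌋₊ ⌊t⌋₊ ×ˢ (Set.univ : Set (ℕ × ℕ)) ∪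
      {p | c ≤ |(p.2.1 : ℝ) - n * a| ∨ c ≤ |(p.2.2 : ℝ) - n * b|} := by
    rintro ⟨ω, p, q⟩ hω
    by_cases h : c ≤ |(p : ℝ) - n * a| ∨ c ≤ |(q : ℝ) - n * b|
    · exact Or.inr h
    · left
      push Not at h
      have h1 := (abs_lt.1 h.1).2
      have h2 := (abs_lt.1 h.2).2
      refine ⟨completedBy_mono C r₁ r₂ ?_ ?_ hω, trivial⟩
      · exact Nat.le_floor (by linarith)
      · exact Nat.le_floor (by push_cast; linarith)
  have h := (measureReal_mono hsub (μ := P.prod ((poissonMeasure (n * a)).prod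
    (poissonMeasure (n * b))))).trans (measureReal_union_le _ _)
  rw [measureReal_prod_prod, probReal_univ, mul_one,
    poissonized_real_eq hn hC hind hunif] at h
  exact h.trans (by gcongr; exact poissonized_deviation_le a b hc)

end Sandwich

/-! ### Asymptotics of the Poisson lower tail -/

section PoissonAsymptotics

variable {a b : ℕ → ℝ≥0} {α β : ℝ}

theorem poissonMeasure_real_Iic (a : ℝ≥0) (r : ℕ) :
    (poissonMeasure a).real (Set.Iic r) =
      ∑ j ∈ Finset.range (r + 1), Real.exp (-a) * a ^ j / j ! := by
  have : Set.Iic r = ((Finset.range (r + 1) : Finset ℕ) : Set ℕ) := by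
    ext k
    simp
  rw [this, ← sum_measureReal_singleton]
  exact Finset.sum_congr rfl fun j _ => poissonMeasure_real_singleton a j

theorem tendsto_poissonMeasure_real_Iic (hb : Tendsto (fun n => (b n : ℝ)) atTop atTop) (r : ℕ) :
    Tendsto (fun n => (poissonMeasure (b n)).real (Set.Iic r)) atTop (𝓝 0) := by
  simp only [poissonMeasure_real_Iic]
  rw [← Finset.sum_const_zero (s := Finset.range (r + 1))]
  refine tendsto_finsetSum _ fun j _ => ?_
  have h := ((Real.tendsto_pow_mul_exp_neg_atTop_nhds_zero j).comp hb).div_const (j ! : ℝ)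
  rw [zero_div] at h
  exact h.congr fun n => by simp [mul_comm]

/-- The top term `j = r` dominates: the term of index `j < r` is smaller by a factor of order `a n ^
(r - j)`. -/
theorem tendsto_mul_poissonMeasure_real_Iic (ha : Tendsto (fun n => (a n : ℝ)) atTop atTop)
    (r : ℕ) (h : Tendsto (fun n : ℕ => n * (Real.exp (-a n) * a n ^ r / r !)) atTop (𝓝 α)) :
    Tendsto (fun n : ℕ => n * (poissonMeasure (a n)).real (Set.Iic r)) atTop (𝓝 α) := by
  simp only [poissonMeasure_real_Iic, Finset.sum_range_succ, mul_add]
  rw [← zero_add α]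
  refine Tendsto.add ?_ h
  simp only [Finset.mul_sum]
  rw [← Finset.sum_const_zero (s := Finset.range r)]
  refine tendsto_finsetSum _ fun j hj => ?_
  have hjr : r - j ≠ 0 := by
    have := Finset.mem_range.1 hj
    omega
  have h1 : Tendsto (fun n => ((a n : ℝ) ^ (r - j))⁻¹) atTop (𝓝 0) :=
    tendsto_inv_atTop_zero.comp ((tendsto_pow_atTop hjr).comp ha)
  have h2 := ((h.mul h1).mul_const ((r ! : ℝ) / j !))
  rw [mul_zero, zero_mul] at h2
  refine h2.congr' ?_
  filter_upwards [ha.eventually_gt_atTop 0] with n hn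
  have e : (a n : ℝ) ^ r = a n ^ j * a n ^ (r - j) := by
    rw [← pow_add]
    congr 1
    have := Finset.mem_range.1 hj
    omega
  rw [e]
  field_simp

/-- Inclusion–exclusion, with `δ` the probability that both requirements fail. A sum at most `r₂`
forces the second summand to be at most `r₂`, which makes the bound on `δ` a product. -/
theorem one_sub_poissonExceed (r₁ r₂ : ℕ) (a b : ℝ≥0) :
    ∃ δ, 0 ≤ δ ∧ δ ≤ (poissonMeasure a).real (Set.Iic r₁) * (poissonMeasure b).real (Set.Iic r₂) ∧
      poissonExceed r₁ r₂ a b = 1 - ((poissonMeasure a).real (Set.Iic r₁) +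
        (poissonMeasure (a + b)).real (Set.Iic r₂) - δ) := by
  set μ := (poissonMeasure a).prod (poissonMeasure b) with hμ
  set A : Set (ℕ × ℕ) := {q | q.1 ≤ r₁} with hA
  set B : Set (ℕ × ℕ) := {q | q.1 + q.2 ≤ r₂} with hB
  have h1 : μ.real A = (poissonMeasure a).real (Set.Iic r₁) := by
    have : A = Set.Iic r₁ ×ˢ Set.univ := by ext; simp [hA]
    rw [this, hμ, measureReal_prod_prod, probReal_univ, mul_one]
  have h2 : μ.real B = (poissonMeasure (a + b)).real (Set.Iic r₂) := by
    rw [← poissonMeasure_conv_poissonMeasure, Measure.conv, map_measureReal_apply (by fun_prop)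
      MeasurableSet.of_discrete]
    rfl
  refine ⟨μ.real (A ∩ B), measureReal_nonneg, ?_, ?_⟩
  · rw [← measureReal_prod_prod]
    refine measureReal_mono fun q hq => ?_
    have := hq.1
    have := hq.2
    simp only [hA, hB, Set.mem_ofPred_eq, Set.mem_prod, Set.mem_Iic] at *
    omega
  · have hc : {q : ℕ × ℕ | r₁ < q.1 ∧ r₂ < q.1 + q.2} = (A ∪ B)ᶜ := by
      ext q
      simp [hA, hB]
    rw [poissonExceed, hc, probReal_compl_eq_one_sub MeasurableSet.of_discrete, ← h1, ← h2]
    have := measureReal_union_add_inter (μ := μ) (s := A) (t := B) MeasurableSet.of_discrete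
    linarith

theorem tendsto_poissonExceed_pow (r₁ r₂ : ℕ)
    (ha : Tendsto (fun n => (a n : ℝ)) atTop atTop) (hb : Tendsto (fun n => (b n : ℝ)) atTop atTop)
    (hα : Tendsto (fun n : ℕ => n * (Real.exp (-a n) * a n ^ r₁ / r₁ !)) atTop (𝓝 α))
    (hβ : Tendsto (fun n : ℕ => n * (Real.exp (-(a n + b n)) * (a n + b n) ^ r₂ / r₂ !)) atTop
      (𝓝 β)) :
    Tendsto (fun n => poissonExceed r₁ r₂ (a n) (b n) ^ n) atTop (𝓝 (Real.exp (-(α + β)))) := by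
  choose δ hδ0 hδ hp using fun n => one_sub_poissonExceed r₁ r₂ (a n) (b n)
  have hA := tendsto_mul_poissonMeasure_real_Iic ha r₁ hα
  have hab : Tendsto (fun n => ((a n + b n : ℝ≥0) : ℝ)) atTop atTop := by
    simp only [NNReal.coe_add]
    exact ha.atTop_add_atTop hb
  have hB := tendsto_mul_poissonMeasure_real_Iic (a := fun n => a n + b n) hab r₂
    (by simpa only [NNReal.coe_add] using hβ)
  -- Here `b → ∞` is used: `n δ` is at most a convergent factor times a vanishing tail probability.
  have hδ' : Tendsto (fun n : ℕ => n * δ n) atTop (𝓝 0) := by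
    have h := hA.mul (tendsto_poissonMeasure_real_Iic hb r₂)
    rw [mul_zero] at h
    refine squeeze_zero (fun n => mul_nonneg n.cast_nonneg (hδ0 n)) (fun n => ?_) h
    rw [mul_assoc]
    exact mul_le_mul_of_nonneg_left (hδ n) n.cast_nonneg
  have h := ((hA.add hB).sub hδ').neg
  rw [sub_zero] at h
  have h' : Tendsto (fun n : ℕ => n * (-((poissonMeasure (a n)).real (Set.Iic r₁) +
        (poissonMeasure (a n + b n)).real (Set.Iic r₂) - δ n))) atTop (𝓝 (-(α + β))) :=
    h.congr fun n => by ring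
  refine (Real.tendsto_one_add_pow_exp_of_tendsto h').congr fun n => ?_
  rw [hp n, ← sub_eq_add_neg]

end PoissonAsymptotics

/-! ### The logarithmic time scale -/

section Normalization

/-- The normalized time scale `log n + r log log n + x` of the completion time of collector `r`. -/
noncomputable def completionScale (r : ℕ) (x : ℝ) (n : ℕ) : ℝ :=
  Real.log n + r * Real.log (Real.log n) + x

theorem tendsto_log_natCast : Tendsto (fun n : ℕ => Real.log n) atTop atTop :=
  Real.tendsto_log_atTop.comp tendsto_natCast_atTop_atTop

theorem tendsto_completionScale_div_log (r : ℕ) (x : ℝ) :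
    Tendsto (fun n : ℕ => completionScale r x n / Real.log n) atTop (𝓝 1) := by
  have h1 : Tendsto (fun n : ℕ => Real.log (Real.log n) / Real.log n) atTop (𝓝 0) :=
    Real.isLittleO_log_id_atTop.tendsto_div_nhds_zero.comp tendsto_log_natCast
  have h2 : Tendsto (fun n : ℕ => x / Real.log n) atTop (𝓝 0) :=
    tendsto_log_natCast.const_div_atTop x
  have h := ((h1.const_mul (r : ℝ)).const_add 1).add h2
  rw [mul_zero, add_zero, add_zero] at h
  refine h.congr' ?_
  filter_upwards [tendsto_log_natCast.eventually_gt_atTop 0] with n hn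
  rw [completionScale]
  field_simp

theorem tendsto_completionScale (r : ℕ) (x : ℝ) :
    Tendsto (completionScale r x) atTop atTop := by
  have h := tendsto_log_natCast.atTop_mul_pos one_pos (tendsto_completionScale_div_log r x)
  refine h.congr' ?_
  filter_upwards [tendsto_log_natCast.eventually_gt_atTop 0] with n hn
  field_simp

/-- The gap is `(r₂ - r₁) log log n` plus a constant. Its divergence, due to `r₁ < r₂`, makes the
two limits independent. -/
theorem tendsto_completionScale_sub {r₁ r₂ : ℕ} (hr : r₁ < r₂) (x y : ℝ) :
    Tendsto (fun n => completionScale r₂ y n - completionScale r₁ x n) atTop atTop := by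
  have hr' : (0 : ℝ) < r₂ - r₁ := by
    rw [sub_pos]
    exact_mod_cast hr
  have h := tendsto_atTop_add_const_right _ (y - x)
    ((Real.tendsto_log_atTop.comp tendsto_log_natCast).const_mul_atTop hr')
  refine h.congr fun n => ?_
  simp only [completionScale, Function.comp]
  ring

/-- The `r log log n` term of the scale contributes `(log n)⁻ʳ` to the exponential, which cancels
the growth of the `r`-th power of the scale. -/
theorem tendsto_mul_exp_completionScale (r : ℕ) (x : ℝ) :
    Tendsto (fun n : ℕ => n * (Real.exp (-completionScale r x n) * completionScale r x n ^ r / r !))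
      atTop (𝓝 (Real.exp (-x) / r !)) := by
  have h := (((tendsto_completionScale_div_log r x).pow r).mul_const (Real.exp (-x) / r !))
  rw [one_pow, one_mul] at h
  refine h.congr' ?_
  filter_upwards [tendsto_log_natCast.eventually_gt_atTop 0, eventually_gt_atTop 0] with n hn hn0
  have e : Real.exp (-completionScale r x n) = (n : ℝ)⁻¹ * (Real.log n ^ r)⁻¹ * Real.exp (-x) := by
    rw [completionScale, neg_add, neg_add, Real.exp_add, Real.exp_add, Real.exp_neg, Real.exp_log
      (by exact_mod_cast hn0), Real.exp_neg, Real.exp_nat_mul, Real.exp_log hn]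
  rw [e]
  have : (n : ℝ) ≠ 0 := by exact_mod_cast hn0.ne'
  rw [div_pow]
  field_simp

theorem tendsto_poissonExceed_completionScale {r₁ r₂ : ℕ} (hr : r₁ < r₂) (x y : ℝ) :
    Tendsto (fun n => poissonExceed r₁ r₂ (completionScale r₁ x n).toNNReal
      (completionScale r₂ y n - completionScale r₁ x n).toNNReal ^ n) atTop
      (𝓝 (Real.exp (-(Real.exp (-x) / r₁ ! + Real.exp (-y) / r₂ !)))) := by
  -- The truncations by `toNNReal` are inactive for large `n`.
  have e1 : ∀ᶠ n in atTop, ((completionScale r₁ x n).toNNReal : ℝ) = completionScale r₁ x n := by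
    filter_upwards [(tendsto_completionScale r₁ x).eventually_ge_atTop 0] with n hn
    exact Real.coe_toNNReal _ hn
  have e2 : ∀ᶠ n in atTop, ((completionScale r₂ y n - completionScale r₁ x n).toNNReal : ℝ) =
      completionScale r₂ y n - completionScale r₁ x n := by
    filter_upwards [(tendsto_completionScale_sub hr x y).eventually_ge_atTop 0] with n hn
    exact Real.coe_toNNReal _ hn
  refine tendsto_poissonExceed_pow r₁ r₂ ?_ ?_ ?_ ?_
  · exact (tendsto_completionScale r₁ x).congr' (e1.mono fun n hn => hn.symm)
  · exact (tendsto_completionScale_sub hr x y).congr' (e2.mono fun n hn => hn.symm)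
  · exact (tendsto_mul_exp_completionScale r₁ x).congr' (e1.mono fun n hn => by simp only [hn])
  · refine (tendsto_mul_exp_completionScale r₂ y).congr' ?_
    filter_upwards [e1, e2] with n h1 h2
    simp only [h1, h2, add_sub_cancel]

end Normalization

/-! ### Convergence and equality of laws from distribution functions -/

section JointCDF

theorem measureReal_Ioc_prod (μ : Measure (ℝ × ℝ)) [IsProbabilityMeasure μ] {a b c d : ℝ}
    (hab : a ≤ b) (hcd : c ≤ d) :
    μ.real (Set.Ioc a b ×ˢ Set.Ioc c d) =
      (μ.real (Set.Iic b ×ˢ Set.Iic d) - μ.real (Set.Iic a ×ˢ Set.Iic d)) -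
        (μ.real (Set.Iic b ×ˢ Set.Iic c) - μ.real (Set.Iic a ×ˢ Set.Iic c)) := by
  have h1 : ∀ y, μ.real (Set.Ioc a b ×ˢ Set.Iic y) =
      μ.real (Set.Iic b ×ˢ Set.Iic y) - μ.real (Set.Iic a ×ˢ Set.Iic y) := by
    intro y
    rw [← measureReal_sdiff (Set.prod_mono (Set.Iic_subset_Iic.2 hab) subset_rfl)
      (measurableSet_Iic.prod measurableSet_Iic)]
    congr 1
    ext p
    simp only [Set.mem_prod, Set.mem_Ioc, Set.mem_Iic, Set.mem_sdiff]
    grind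
  rw [← h1, ← h1, ← measureReal_sdiff (Set.prod_mono subset_rfl (Set.Iic_subset_Iic.2 hcd))
      (measurableSet_Ioc.prod measurableSet_Iic)]
  congr 1
  ext p
  simp only [Set.mem_prod, Set.mem_Ioc, Set.mem_Iic, Set.mem_sdiff]
  grind

/-- Pointwise convergence of the joint distribution functions implies weak convergence. -/
theorem tendsto_probabilityMeasure_of_tendsto_Iic_prod {ι : Type*} {l : Filter ι}
    [l.IsCountablyGenerated] {μ : ι → ProbabilityMeasure (ℝ × ℝ)} {ν : ProbabilityMeasure (ℝ × ℝ)}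
    (h : ∀ x y, Tendsto (fun i => (μ i : Measure (ℝ × ℝ)).real (Set.Iic x ×ˢ Set.Iic y)) l
      (𝓝 ((ν : Measure (ℝ × ℝ)).real (Set.Iic x ×ˢ Set.Iic y)))) : Tendsto μ l (𝓝 ν) := by
  -- Half-open rectangles form a π-system, contain neighbourhoods of each point inside any open set
  -- around it, and have measures given by four values of the distribution function.
  let S : Set (Set (ℝ × ℝ)) := {s | ∃ a b c d : ℝ, s = Set.Ioc a b ×ˢ Set.Ioc c d}
  have hS : IsPiSystem S := by
    rintro _ ⟨a, b, c, d, rfl⟩ _ ⟨a', b', c', d', rfl⟩ -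
    exact ⟨_, _, _, _, by rw [Set.prod_inter_prod, Set.Ioc_inter_Ioc, Set.Ioc_inter_Ioc]⟩
  refine hS.tendsto_probabilityMeasure_of_tendsto_of_mem ?_ ?_ ?_
  · rintro _ ⟨a, b, c, d, rfl⟩
    exact measurableSet_Ioc.prod measurableSet_Ioc
  · intro u hu p hp
    obtain ⟨ε, hε, hball⟩ := Metric.nhds_basis_closedBall.mem_iff.1 (hu.mem_nhds hp)
    refine ⟨_, ⟨p.1 - ε, p.1 + ε, p.2 - ε, p.2 + ε, rfl⟩, ?_, ?_⟩
    · exact prod_mem_nhds (Ioc_mem_nhds (by linarith) (by linarith))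
        (Ioc_mem_nhds (by linarith) (by linarith))
    · refine subset_trans ?_ hball
      rw [← closedBall_prod_same, Real.closedBall_eq_Icc, Real.closedBall_eq_Icc]
      exact Set.prod_mono Set.Ioc_subset_Icc_self Set.Ioc_subset_Icc_self
  · rintro _ ⟨a, b, c, d, rfl⟩
    have key : Tendsto (fun i => (μ i : Measure (ℝ × ℝ)).real (Set.Ioc a b ×ˢ Set.Ioc c d)) l
        (𝓝 ((ν : Measure (ℝ × ℝ)).real (Set.Ioc a b ×ˢ Set.Ioc c d))) := by
      rcases lt_or_ge b a with hab | hab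
      · simpa [Set.Ioc_eq_empty_of_le hab.le] using tendsto_const_nhds
      rcases lt_or_ge d c with hcd | hcd
      · simpa [Set.Ioc_eq_empty_of_le hcd.le] using tendsto_const_nhds
      simp only [measureReal_Ioc_prod _ hab hcd]
      exact ((h b d).sub (h a d)).sub ((h b c).sub (h a c))
    simpa using key

theorem ext_of_Iio_real {μ ν : Measure ℝ} [IsProbabilityMeasure μ] [IsProbabilityMeasure ν]
    (h : ∀ x, μ.real (Set.Iio x) = ν.real (Set.Iio x)) : μ = ν := by
  refine ext_of_generate_finite _ (BorelSpace.measurable_eq.trans (borel_eq_generateFrom_Iio ℝ))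
    isPiSystem_Iio ?_ (by simp)
  rintro _ ⟨x, rfl⟩
  exact (measureReal_eq_measureReal_iff).1 (h x)

end JointCDF

/-! ### Gumbel variables from exponential ones -/

section Gumbel

instance : IsProbabilityMeasure (expMeasure 1) := isProbabilityMeasure_expMeasure one_pos

/-- Absence of atoms makes strict and weak inequalities interchangeable in
`expMeasure_real_gumbel_le`. -/
instance : NullSingletonClass (expMeasure 1) :=
  ⟨fun _ => withDensity_absolutelyContinuous volume (exponentialPDF 1) (measure_singleton _)⟩

theorem expMeasure_real_Iic {c : ℝ} (hc : 0 ≤ c) :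
    (expMeasure 1).real (Set.Iic c) = 1 - Real.exp (-c) := by
  rw [← cdf_eq_real, cdf_expMeasure_eq one_pos, if_pos hc, one_mul]

theorem expMeasure_real_Ioi {c : ℝ} (hc : 0 ≤ c) :
    (expMeasure 1).real (Set.Ioi c) = Real.exp (-c) := by
  rw [← Set.compl_Iic, probReal_compl_eq_one_sub measurableSet_Iic, expMeasure_real_Iic hc]
  ring

theorem ae_expMeasure_pos : ∀ᵐ u ∂expMeasure 1, 0 < u := by
  have h := expMeasure_real_Iic le_rfl
  rw [neg_zero, Real.exp_zero, sub_self, measureReal_eq_zero_iff] at h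
  rw [ae_iff]
  simpa [Set.Iic] using h

/-- If `u` is a standard exponential variable then `gumbel r u` is a Gumbel variable with
distribution function `exp (- exp (-x) / r!)`. -/
noncomputable def gumbel (r : ℕ) (u : ℝ) : ℝ := -Real.log (r ! * u)

theorem measurable_gumbel (r : ℕ) : Measurable (gumbel r) := by
  unfold gumbel
  fun_prop

theorem expMeasure_real_gumbel_le (r : ℕ) (x : ℝ) :
    (expMeasure 1).real {u | gumbel r u ≤ x} = Real.exp (-(Real.exp (-x) / r !)) := by
  rw [← expMeasure_real_Ioi (by positivity), measureReal_congr Ioi_ae_eq_Ici]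
  refine measureReal_congr ?_
  filter_upwards [ae_expMeasure_pos] with u hu
  have hr : (0 : ℝ) < r ! := by positivity
  refine propext ?_
  change gumbel r u ≤ x ↔ Real.exp (-x) / r ! ≤ u
  rw [gumbel, neg_le, Real.le_log_iff_exp_le (by positivity), div_le_iff₀' hr]

/-- Tilting the density by `exp (-(k u))` gives `1 / (1 + k)` times the exponential density of rate
`1 + k`, whose total mass is one. -/
theorem lintegral_exp_neg_mul_expMeasure {k : ℝ} (hk : 0 < k) :
    ∫⁻ u, ENNReal.ofReal (Real.exp (-(k * u))) ∂expMeasure 1 = ENNReal.ofReal (1 / (1 + k)) := by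
  have hk1 : 0 < 1 + k := by linarith
  have hm : Measurable (exponentialPDF 1) := (measurable_exponentialPDFReal 1).ennreal_ofReal
  have h : expMeasure 1 = volume.withDensity (exponentialPDF 1) := rfl
  rw [h, lintegral_withDensity_eq_lintegral_mul _ hm (by fun_prop)]
  have e : ∀ u, (exponentialPDF 1 * fun u => ENNReal.ofReal (Real.exp (-(k * u)))) u =
      ENNReal.ofReal (1 / (1 + k)) * exponentialPDF (1 + k) u := by
    intro u
    rw [Pi.mul_apply, exponentialPDF_eq, exponentialPDF_eq]
    split_ifs with hu
    · rw [← ENNReal.ofReal_mul (by positivity), ← ENNReal.ofReal_mul (by positivity)]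
      congr 1
      have : Real.exp (-((1 + k) * u)) = Real.exp (-(1 * u)) * Real.exp (-(k * u)) := by
        rw [← Real.exp_add]
        ring_nf
      rw [this]
      field_simp
    · simp
  simp only [e]
  have hm' : Measurable (exponentialPDF (1 + k)) :=
    (measurable_exponentialPDFReal _).ennreal_ofReal
  rw [lintegral_const_mul _ hm', lintegral_exponentialPDF_eq_one hk1, mul_one]

/-- The difference of two independent Gumbel variables is logistic. -/
theorem real_gumbel_sub_gumbel_lt (r₁ r₂ : ℕ) (x : ℝ) :
    ((expMeasure 1).prod (expMeasure 1)).real {e | gumbel r₂ e.2 - gumbel r₁ e.1 < x} =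
      (r₂ ! : ℝ) / (r₂ ! + r₁ ! * Real.exp (-x)) := by
  have h1 : (0 : ℝ) < r₁ ! := by positivity
  have h2 : (0 : ℝ) < r₂ ! := by positivity
  set k : ℝ := r₁ ! * Real.exp (-x) / r₂ ! with hk
  have hk0 : 0 < k := by positivity
  have hmeas : MeasurableSet {e : ℝ × ℝ | gumbel r₂ e.2 - gumbel r₁ e.1 < x} :=
    measurableSet_lt (((measurable_gumbel r₂).comp measurable_snd).sub
      ((measurable_gumbel r₁).comp measurable_fst)) measurable_const
  rw [measureReal_def, Measure.prod_apply hmeas]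
  -- For fixed `u > 0` the condition on `v > 0` reads `k u < v`, so the remaining integral is a
  -- Laplace transform at `k`.
  have hsec : ∀ᵐ u ∂expMeasure 1, expMeasure 1
      (Prod.mk u ⁻¹' {e : ℝ × ℝ | gumbel r₂ e.2 - gumbel r₁ e.1 < x}) =
      ENNReal.ofReal (Real.exp (-(k * u))) := by
    filter_upwards [ae_expMeasure_pos] with u hu
    rw [← expMeasure_real_Ioi (by positivity), ofReal_measureReal]
    refine measure_congr ?_
    filter_upwards [ae_expMeasure_pos] with v hv
    refine propext ?_
    change gumbel r₂ v - gumbel r₁ u < x ↔ k * u < v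
    have e1 : gumbel r₂ v - gumbel r₁ u < x ↔ Real.log (r₁ ! * u) < x + Real.log (r₂ ! * v) := by
      unfold gumbel
      constructor <;> intro h <;> linarith
    rw [e1, Real.log_lt_iff_lt_exp (by positivity), Real.exp_add, Real.exp_log (by positivity), hk,
      Real.exp_neg]
    have hx := Real.exp_pos x
    rw [← mul_inv_lt_iff₀' hx, div_mul_eq_mul_div, div_lt_iff₀ h2]
    ring_nf
  rw [lintegral_congr_ae hsec, lintegral_exp_neg_mul_expMeasure hk0,
    ENNReal.toReal_ofReal (by positivity), hk]
  field_simp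

end Gumbel

/-! ### Measurability and finiteness of completion times -/

section CompletionTime

variable {Ω : Type*} [MeasurableSpace Ω] {P : Measure Ω} {n : ℕ} {C : ℕ → Ω → Fin n}

theorem measurable_completionTime (hC : ∀ k, Measurable (C k)) (r : ℕ) :
    Measurable fun ω => completionTime (fun k => C k ω) r := by
  have hm : ∀ t, MeasurableSet {ω | album (fun k => C k ω) t r = Set.univ} := by
    intro t
    simp only [album_eq_univ_iff]
    have h := measurable_couponCount hC (Finset.range t)
    have e : {ω | ∀ i, r < couponCount (fun k => C k ω) (Finset.range t) i} =
        ⋂ i, {ω | r < couponCount (fun k => C k ω) (Finset.range t) i} := by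
      ext ω
      simp
    rw [e]
    exact MeasurableSet.iInter fun i =>
      measurableSet_lt measurable_const ((measurable_pi_apply i).comp h)
  refine measurable_of_Iic fun m => ?_
  -- The last set, where the album is never full, belongs here because the time is then `0` by
  -- convention.
  have e : (fun ω => completionTime (fun k => C k ω) r) ⁻¹' Set.Iic m =
      (⋃ t ∈ Set.Iic m, {ω | album (fun k => C k ω) t r = Set.univ}) ∪
      ⋂ t, {ω | album (fun k => C k ω) t r = Set.univ}ᶜ := by
    ext ω
    simp only [Set.mem_preimage, Set.mem_Iic, Set.mem_union, Set.mem_iUnion, Set.mem_iInter,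
      Set.mem_compl_iff, Set.mem_ofPred_eq, exists_prop]
    constructor
    · intro h
      by_cases hex : ∃ t, album (fun k => C k ω) t r = Set.univ
      · exact Or.inl ⟨_, h, Nat.sInf_mem (s := {t | album (fun k => C k ω) t r = Set.univ}) hex⟩
      · exact Or.inr fun t ht => hex ⟨t, ht⟩
    · rintro (⟨t, ht, h⟩ | h)
      · exact (Nat.sInf_le (s := {t | album (fun k => C k ω) t r = Set.univ}) h).trans ht
      · have : {t | album (fun k => C k ω) t r = Set.univ} = ∅ := by
          ext t
          simp [h t]
        rw [completionTime, this, Nat.sInf_empty]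
        exact Nat.zero_le m
  rw [e]
  exact (MeasurableSet.biUnion (Set.to_countable _) fun t _ => hm t).union
    (MeasurableSet.iInter fun t => (hm t).compl)

variable [IsProbabilityMeasure P]

/-- By the second Borel–Cantelli lemma. It makes every collection complete almost surely. -/
theorem ae_forall_frequently_eq (hC : ∀ k, Measurable (C k))
    (hind : iIndepFun C P) (hunif : ∀ k i, P.real {ω | C k ω = i} = 1 / (n : ℝ)) :
    ∀ᵐ ω ∂P, ∀ i, ∃ᶠ k in atTop, C k ω = i := by
  rw [ae_all_iff]
  intro i
  have hn : n ≠ 0 := fun h => (h ▸ i).elim0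
  have hm : ∀ k, MeasurableSet {ω | C k ω = i} := fun k => hC k (measurableSet_singleton i)
  have hs : iIndepSet (fun k => {ω | C k ω = i}) P := by
    rw [iIndepSet_iff_meas_biInter hm]
    intro s
    exact hind.meas_biInter fun k _ => ⟨{i}, measurableSet_singleton i, rfl⟩
  have hP : ∀ k, P {ω | C k ω = i} = ENNReal.ofReal (1 / (n : ℝ)) := fun k => by
    rw [← hunif k i, ofReal_measureReal]
  have h := measure_limsup_eq_one hm hs (by
    simp only [hP]
    refine ENNReal.tsum_const_eq_top_of_ne_zero ?_
    simpa using hn)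
  have h' := (prob_compl_eq_zero_iff (MeasurableSet.measurableSet_limsup hm)).2 h
  rw [ae_iff]
  convert h' using 2
  ext ω
  simp [mem_limsup_iff_frequently_mem]

/-- The normalized completion time of collector `r`. -/
noncomputable def normalizedTime {n : ℕ} (c : ℕ → Fin n) (r : ℕ) : ℝ :=
  (completionTime c r : ℝ) / n - Real.log n - r * Real.log (Real.log n)

theorem measurable_normalizedTime (hC : ∀ k, Measurable (C k)) (r : ℕ) :
    Measurable fun ω => normalizedTime (fun k => C k ω) r := by
  have h : Measurable fun ω => (completionTime (fun k => C k ω) r : ℝ) :=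
    (measurable_from_top (f := (Nat.cast : ℕ → ℝ))).comp (measurable_completionTime hC r)
  exact ((h.div_const _).sub_const _).sub_const _

theorem normalizedTime_le_iff (hn : n ≠ 0) (c : ℕ → Fin n) (r : ℕ) (x : ℝ)
    (hc : ∃ t, album c t r = Set.univ) (h0 : 0 ≤ completionScale r x n) :
    normalizedTime c r ≤ x ↔
      ∀ i, r < couponCount c (Finset.range ⌊n * completionScale r x n⌋₊) i := by
  have hn' : (0 : ℝ) < n := by exact_mod_cast Nat.pos_of_ne_zero hn
  rw [← completionTime_le_iff c r _ hc, Nat.le_floor_iff (by positivity), ← div_le_iff₀' hn',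
    normalizedTime, completionScale]
  constructor <;> intro h <;> linarith

theorem measureReal_normalizedTime_le (hn : n ≠ 0) (hC : ∀ k, Measurable (C k))
    (hind : iIndepFun C P) (hunif : ∀ k i, P.real {ω | C k ω = i} = 1 / (n : ℝ))
    (r₁ r₂ : ℕ) (x y : ℝ) (hx : 0 ≤ completionScale r₁ x n) (hy : 0 ≤ completionScale r₂ y n) :
    P.real {ω | normalizedTime (fun k => C k ω) r₁ ≤ x ∧ normalizedTime (fun k => C k ω) r₂ ≤ y} =
      P.real (completedBy C r₁ r₂ ⌊n * completionScale r₁ x n⌋₊ ⌊n * completionScale r₂ y n⌋₊) := by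
  refine measureReal_congr ?_
  filter_upwards [ae_forall_frequently_eq hC hind hunif] with ω hω
  refine propext ?_
  change normalizedTime (fun k => C k ω) r₁ ≤ x ∧ normalizedTime (fun k => C k ω) r₂ ≤ y ↔
    ∀ i, _ ∧ _
  rw [normalizedTime_le_iff hn _ r₁ x (exists_album_eq_univ _ r₁ hω) hx,
    normalizedTime_le_iff hn _ r₂ y (exists_album_eq_univ _ r₂ hω) hy, forall_and]

end CompletionTime

/-! ### The joint Gumbel limit -/

section Limit

theorem tendsto_completionScale_div (r : ℕ) (x : ℝ) :
    Tendsto (fun n : ℕ => completionScale r x n / n) atTop (𝓝 0) := by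
  have h1 : Tendsto (fun n : ℕ => Real.log n / n) atTop (𝓝 0) :=
    Real.isLittleO_log_id_atTop.tendsto_div_nhds_zero.comp tendsto_natCast_atTop_atTop
  have h := (tendsto_completionScale_div_log r x).mul h1
  rw [mul_zero] at h
  refine h.congr' ?_
  filter_upwards [tendsto_log_natCast.eventually_gt_atTop 0] with n hn
  field_simp

variable {Ω : ℕ+ → Type*} [∀ n, MeasurableSpace (Ω n)]
  {P : ∀ n, Measure (Ω n)} [∀ n, IsProbabilityMeasure (P n)]
  {C : ∀ n : ℕ+, ℕ → Ω n → Fin n}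

/-- The joint distribution function of two normalized completion times converges to a product of
Gumbel distribution functions. -/
theorem tendsto_measureReal_normalizedTime_le (hC : ∀ n k, Measurable (C n k))
    (hind : ∀ n, iIndepFun (C n) (P n))
    (hunif : ∀ (n : ℕ+) (k : ℕ) (i : Fin n), (P n).real {ω | C n k ω = i} = 1 / (n : ℝ))
    {r₁ r₂ : ℕ} (hr : r₁ < r₂) (x y : ℝ) :
    Tendsto (fun n => (P n).real {ω | normalizedTime (fun k => C n k ω) r₁ ≤ x ∧
        normalizedTime (fun k => C n k ω) r₂ ≤ y}) atTop
      (𝓝 (Real.exp (-(Real.exp (-x) / r₁ ! + Real.exp (-y) / r₂ !)))) := by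
  -- Shifting `x` by `ε` and `y` by `2 ε` changes the mean length of each block by `n ε`, the
  -- deviation allowed to it; `err` is the resulting Chebyshev bound with `c = n |ε|`. Positive `ε`
  -- gives upper bounds and negative `ε` lower bounds.
  let G : ℝ → ℝ := fun ε =>
    Real.exp (-(Real.exp (-(x + ε)) / r₁ ! + Real.exp (-(y + 2 * ε)) / r₂ !))
  let q : ℝ → ℕ → ℝ := fun ε n => poissonExceed r₁ r₂ (completionScale r₁ (x + ε) n).toNNReal
      (completionScale r₂ (y + 2 * ε) n - completionScale r₁ (x + ε) n).toNNReal ^ n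
  let err : ℝ → ℕ → ℝ := fun ε n => completionScale r₂ (y + 2 * ε) n / n / ε ^ 2
  have hG : Continuous G := by fun_prop
  have hG0 : G 0 = Real.exp (-(Real.exp (-x) / r₁ ! + Real.exp (-y) / r₂ !)) := by simp [G]
  have hq : ∀ ε, Tendsto (q ε) atTop (𝓝 (G ε)) := fun ε =>
    tendsto_poissonExceed_completionScale hr (x + ε) (y + 2 * ε)
  have herr : ∀ ε, Tendsto (err ε) atTop (𝓝 0) := fun ε => by
    simpa using (tendsto_completionScale_div r₂ (y + 2 * ε)).div_const (ε ^ 2)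
  have hpos : ∀ ε, ∀ᶠ n : ℕ+ in atTop, 0 ≤ completionScale r₁ (x + ε) n ∧
      0 ≤ completionScale r₂ (y + 2 * ε) n - completionScale r₁ (x + ε) n := fun ε =>
    tendsto_PNat_val_atTop_atTop.eventually
      (((tendsto_completionScale r₁ (x + ε)).eventually_ge_atTop 0).and
        ((tendsto_completionScale_sub hr (x + ε) (y + 2 * ε)).eventually_ge_atTop 0))
  have hshift : ∀ (r : ℕ) (z δ : ℝ) (n : ℕ),
      completionScale r (z + δ) n = completionScale r z n + δ := fun r z δ n => by
    simp only [completionScale]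
    ring
  have herr_eq : ∀ (ε : ℝ) (n : ℕ+) (a b : ℝ), a + b = completionScale r₂ (y + 2 * ε) n →
      (n : ℝ) * (a + b) / (n * |ε|) ^ 2 = err ε n := fun ε n a b hab => by
    have : (n : ℝ) ≠ 0 := by exact_mod_cast n.ne_zero
    simp only [err]
    rw [hab, mul_pow, sq_abs]
    field_simp
  have hrewrite : ∀ᶠ n : ℕ+ in atTop, (P n).real {ω | normalizedTime (fun k => C n k ω) r₁ ≤ x ∧
        normalizedTime (fun k => C n k ω) r₂ ≤ y} =
      (P n).real (completedBy (C n) r₁ r₂ ⌊(n : ℕ) * completionScale r₁ x n⌋₊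
        ⌊(n : ℕ) * completionScale r₂ y n⌋₊) := by
    filter_upwards [hpos 0] with n hn
    simp only [mul_zero, add_zero] at hn
    exact measureReal_normalizedTime_le n.ne_zero (hC n) (hind n) (hunif n) r₁ r₂ x y hn.1
      (by linarith)
  have hupper : ∀ ε > 0, ∀ᶠ n : ℕ+ in atTop,
      (P n).real {ω | normalizedTime (fun k => C n k ω) r₁ ≤ x ∧
        normalizedTime (fun k => C n k ω) r₂ ≤ y} ≤ q ε n + err ε n := by
    intro ε hε
    filter_upwards [hpos ε, hrewrite] with n hn hrw
    have hn0 : (0 : ℝ) < (n : ℕ) := by exact_mod_cast n.pos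
    have h := measureReal_completedBy_le n.ne_zero (hC n) (hind n) (hunif n) r₁ r₂
      (completionScale r₁ (x + ε) n).toNNReal
      (completionScale r₂ (y + 2 * ε) n - completionScale r₁ (x + ε) n).toNNReal
      (c := (n : ℕ) * |ε|) (s := (n : ℕ) * completionScale r₁ x n)
      (t := (n : ℕ) * completionScale r₂ y n) (by positivity)
      (by rw [Real.coe_toNNReal _ hn.1, hshift, abs_of_pos hε]; linarith)
      (by rw [Real.coe_toNNReal _ hn.2, hshift, hshift, abs_of_pos hε]; linarith)
    rw [herr_eq _ _ _ _ (by
      rw [Real.coe_toNNReal _ hn.1, Real.coe_toNNReal _ hn.2, add_sub_cancel])] at h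
    rw [hrw]
    exact h
  have hlower : ∀ ε < 0, ∀ᶠ n : ℕ+ in atTop, q ε n - err ε n ≤
      (P n).real {ω | normalizedTime (fun k => C n k ω) r₁ ≤ x ∧
        normalizedTime (fun k => C n k ω) r₂ ≤ y} := by
    intro ε hε
    filter_upwards [hpos ε, hrewrite] with n hn hrw
    have hn0 : (0 : ℝ) < (n : ℕ) := by exact_mod_cast n.pos
    have h := le_measureReal_completedBy n.ne_zero (hC n) (hind n) (hunif n) r₁ r₂
      (completionScale r₁ (x + ε) n).toNNReal
      (completionScale r₂ (y + 2 * ε) n - completionScale r₁ (x + ε) n).toNNReal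
      (c := (n : ℕ) * |ε|) (s := (n : ℕ) * completionScale r₁ x n)
      (t := (n : ℕ) * completionScale r₂ y n) (mul_pos hn0 (abs_pos.2 hε.ne))
      (by rw [Real.coe_toNNReal _ hn.1, hshift, abs_of_neg hε]; linarith)
      (by rw [Real.coe_toNNReal _ hn.2, hshift, hshift, abs_of_neg hε]; linarith)
    rw [herr_eq _ _ _ _ (by
      rw [Real.coe_toNNReal _ hn.1, Real.coe_toNNReal _ hn.2, add_sub_cancel])] at h
    rw [hrw]
    exact sub_le_iff_le_add.2 h
  -- For a strict bound on the limit, continuity of `G` at `0` provides a fixed `ε` of the right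
  -- sign; only then does `n` tend to infinity.
  rw [← hG0, tendsto_order]
  have hG' : Tendsto G (𝓝 0) (𝓝 (G 0)) := hG.tendsto 0
  constructor
  · intro u hu
    obtain ⟨ε, hε, hε0⟩ := (((hG'.mono_left nhdsWithin_le_nhds).eventually_const_lt hu).and
      (self_mem_nhdsWithin (s := Set.Iio (0 : ℝ)))).exists
    have h := (hq ε).sub (herr ε)
    rw [sub_zero] at h
    filter_upwards [tendsto_PNat_val_atTop_atTop.eventually (h.eventually_const_lt hε),
      hlower ε hε0] with n h1 h2
    exact h1.trans_le h2
  · intro u hu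
    obtain ⟨ε, hε, hε0⟩ := (((hG'.mono_left nhdsWithin_le_nhds).eventually_lt_const hu).and
      (self_mem_nhdsWithin (s := Set.Ioi (0 : ℝ)))).exists
    have h := (hq ε).add (herr ε)
    rw [add_zero] at h
    filter_upwards [tendsto_PNat_val_atTop_atTop.eventually (h.eventually_lt_const hε),
      hupper ε hε0] with n h1 h2
    exact h2.trans_lt h1

/-- Two normalized completion times converge jointly to independent Gumbel variables. -/
theorem tendstoInDistribution_normalizedTime (hC : ∀ n k, Measurable (C n k))
    (hind : ∀ n, iIndepFun (C n) (P n))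
    (hunif : ∀ (n : ℕ+) (k : ℕ) (i : Fin n), (P n).real {ω | C n k ω = i} = 1 / (n : ℝ))
    {r₁ r₂ : ℕ} (hr : r₁ < r₂) :
    TendstoInDistribution
      (fun (n : ℕ+) (ω : Ω n) => (normalizedTime (fun k => C n k ω) r₁,
        normalizedTime (fun k => C n k ω) r₂)) atTop
      (fun e : ℝ × ℝ => (gumbel r₁ e.1, gumbel r₂ e.2)) P
      ((expMeasure 1).prod (expMeasure 1)) := by
  have hm : ∀ n : ℕ+, Measurable fun ω : Ω n => (normalizedTime (fun k => C n k ω) r₁,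
      normalizedTime (fun k => C n k ω) r₂) := fun n =>
    (measurable_normalizedTime (hC n) r₁).prodMk (measurable_normalizedTime (hC n) r₂)
  have hg : Measurable fun e : ℝ × ℝ => (gumbel r₁ e.1, gumbel r₂ e.2) :=
    ((measurable_gumbel r₁).comp measurable_fst).prodMk
      ((measurable_gumbel r₂).comp measurable_snd)
  refine ⟨fun n => (hm n).aemeasurable, hg.aemeasurable, ?_⟩
  refine tendsto_probabilityMeasure_of_tendsto_Iic_prod fun x y => ?_
  have hlim : (((expMeasure 1).prod (expMeasure 1)).map
      fun e : ℝ × ℝ => (gumbel r₁ e.1, gumbel r₂ e.2)).real (Set.Iic x ×ˢ Set.Iic y) =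
      Real.exp (-(Real.exp (-x) / r₁ ! + Real.exp (-y) / r₂ !)) := by
    rw [map_measureReal_apply hg (measurableSet_Iic.prod measurableSet_Iic)]
    have : (fun e : ℝ × ℝ => (gumbel r₁ e.1, gumbel r₂ e.2)) ⁻¹' (Set.Iic x ×ˢ Set.Iic y) =
        {u | gumbel r₁ u ≤ x} ×ˢ {u | gumbel r₂ u ≤ y} := rfl
    rw [this, measureReal_prod_prod, expMeasure_real_gumbel_le, expMeasure_real_gumbel_le,
      ← Real.exp_add]
    congr 1
    ring
  have h := tendsto_measureReal_normalizedTime_le hC hind hunif hr x y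
  rw [← hlim] at h
  refine h.congr fun n => ?_
  exact (map_measureReal_apply (hm n) (measurableSet_Iic.prod measurableSet_Iic)).symm

end Limit

/-! ### The logistic limit of the inter-completion time -/

theorem corollary1 {Ω : ℕ+ → Type*} [∀ n, MeasurableSpace (Ω n)]
    (P : ∀ n, Measure (Ω n)) [∀ n, IsProbabilityMeasure (P n)]
    (C : ∀ n : ℕ+, ℕ → Ω n → Fin n)
    (hC_meas : ∀ n k, Measurable (C n k))
    (hC_indep : ∀ n, iIndepFun (C n) (P n))
    (hC_unif : ∀ (n : ℕ+) (k : ℕ) (i : Fin n), (P n).real {ω | C n k ω = i} = 1 / (n : ℝ))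
    (r₁ r₂ : ℕ) (hr : r₁ < r₂)
    {Ω' : Type*} [MeasurableSpace Ω'] (Q : Measure Ω') [IsProbabilityMeasure Q]
    (L : Ω' → ℝ) (hL_meas : Measurable L)
    (hL : ∀ x : ℝ, Q.real {ω | L ω < x} =
      (r₂.factorial : ℝ) / ((r₂.factorial : ℝ) + (r₁.factorial : ℝ) * Real.exp (-x))) :
    TendstoInDistribution
      (fun (n : ℕ+) (ω : Ω n) =>
        interCompletionTime (fun k => C n k ω) r₁ r₂ / (n : ℝ) -
          ((r₂ : ℝ) - (r₁ : ℝ)) * Real.log (Real.log (n : ℝ)))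
      atTop L P Q := by
  have hsub : Continuous fun p : ℝ × ℝ => p.2 - p.1 := by fun_prop
  have h := (tendstoInDistribution_normalizedTime hC_meas hC_indep hC_unif hr).continuous_comp hsub
  have hfun : (fun (n : ℕ+) (ω : Ω n) =>
        interCompletionTime (fun k => C n k ω) r₁ r₂ / (n : ℝ) -
          ((r₂ : ℝ) - (r₁ : ℝ)) * Real.log (Real.log (n : ℝ))) =
      fun n => (fun p : ℝ × ℝ => p.2 - p.1) ∘ fun ω : Ω n =>
        (normalizedTime (fun k => C n k ω) r₁, normalizedTime (fun k => C n k ω) r₂) := by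
    ext n ω
    simp only [interCompletionTime, normalizedTime, Function.comp]
    ring
  -- `L` may live on any space; only its law matters, and the values on the rays `Iio x` determine
  -- it.
  have hmap : ((expMeasure 1).prod (expMeasure 1)).map
      ((fun p : ℝ × ℝ => p.2 - p.1) ∘ fun e : ℝ × ℝ => (gumbel r₁ e.1, gumbel r₂ e.2)) =
      Q.map L := by
    have := Measure.isProbabilityMeasure_map (μ := Q) hL_meas.aemeasurable
    have := Measure.isProbabilityMeasure_map h.aemeasurable_limit
    refine ext_of_Iio_real fun x => ?_
    rw [map_measureReal_apply hL_meas measurableSet_Iio,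
      map_measureReal_apply_of_aemeasurable h.aemeasurable_limit measurableSet_Iio]
    exact (real_gumbel_sub_gumbel_lt r₁ r₂ x).trans (hL x).symm
  rw [hfun]
  refine ⟨h.forall_aemeasurable, hL_meas.aemeasurable, ?_⟩
  have hlim : (⟨Q.map L, Measure.isProbabilityMeasure_map hL_meas.aemeasurable⟩ :
      ProbabilityMeasure ℝ) = ⟨_, Measure.isProbabilityMeasure_map h.aemeasurable_limit⟩ :=
    Subtype.ext hmap.symm
  rw [hlim]
  exact h.tendsto
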